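/- Let $B_n=\{0,1\}^n$ and, for $X=(x_1,\dots,x_n)\in B_n$, let $|X|=\sum_i x_i$ and $a_X=|X|/n$. A quantum algorithm with $T$ queries acts on a finite number of qubits: starting from a unit vector $|\psi_0\rangle$ it forms $|\psi\rangle=U_TQ_XU_{T-1}Q_X\cdots U_1Q_XU_0|\psi_0\rangle$, where the unitaries $U_0,\dots,U_T$ do not depend on $X$ and $Q_X|i\rangle|b\rangle|z\rangle=|i\rangle|b\oplus x_i\rangle|z\rangle$ (the index register is large enough to hold all $n$ indices, and $Q_X$ acts as the identity on index values that correspond to no variable). A projective measurement of $|\psi\rangle$ then gives one of finitely many outcomes $j$, with probability $p_X(j)$, and the algorithm outputs a real number $\hat a(j)$ as an approximation to $a_X$ (that is, $n\hat a(j)$ as an approximate count of the ones). For $\tfrac12<p\le 1$ put $$e(X,T,p)=\inf\Big\{\gamma:\ \sum_{j:\,|a_X-\hat a(j)|\le\gamma}p_X(j)\ge p\Big\},$$ and, for a probability measure $\mu$ on $B_n$, let the average probabilistic error of approximate counting be $$e_1^{\mathrm{avg\text{-}prob}}(B_n,T,p)=n\sum_{X\in B_n}e(X,T,p)\,\mu(X).$$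 **Corollary 3.1.** Fix $p\in(\tfrac12,1]$. For every $n$ let $I=I_n\subseteq\{0,\dots,n\}$ be a set of consecutive integers such that $|I|\to\infty$ as $n\to\infty$ and $k(n-k)=\Theta(n^2)$ uniformly for $k\in I$, and let $\mu=\mu_n$ be a probability measure on $B_n$ such that $$\mu(X)=\Omega(|I|^{-1})\,\frac1{\binom n{|X|}}\qquad\text{for every } X\in B_n \text{ with } |X|\in I,$$ uniformly in $X$. Let $\Delta=\Delta_n>0$ satisfy $\Delta=o(|I|)$. Then for any quantum algorithm with $T$ queries the condition $e_1^{\mathrm{avg\text{-}prob}}(B_n,T,p)\le\Delta$ implies that $T=\Omega(\min(n/\Delta,n))$. More explicitly: there is a constant $C>0$, which depends only on $p$ and on the constants implied in the $\Theta$ and $\Omega$ of the hypotheses, such that for all such sequences $(I_n),(\mu_n),(\Delta_n)$ and all sufficiently large $n$ (how large may depend on the sequences), every $T$ and every quantum algorithm with $T$ queries on $B_n$ and with $e_1^{\mathrm{avg\text{-}prob}}(B_n,T,p)\le\Delta_n$ satisfies $T\ge C\min(n/\Delta_n,n)$. -/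

import Mathlib

open Filter Asymptotics MeasureTheory

noncomputable section

namespace QuantumMean

/-- The inputs `B_n = {0,1}^n`. -/
abbrev Input (n : ℕ) : Type := Fin n → Bool

/-- `|X|`, the number of ones of `X`. -/
def weight {n : ℕ} (X : Input n) : ℕ := (Finset.univ.filter fun i => X i = true).card

/-- The Boolean mean `a_X = |X| / n`. -/
def mean {n : ℕ} (X : Input n) : ℝ := (weight X : ℝ) / (n : ℝ)

/-- Labels `|i⟩|b⟩|z⟩` of the computational basis of `m = ℓ + 1 + w` qubits: an index register of
`ℓ` qubits, one answer qubit, and a work space of `w` qubits. -/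
abbrev BasisLabel (l w : ℕ) : Type := Fin (2 ^ l) × Bool × Fin (2 ^ w)

/-- The Hilbert space `ℂ² ⊗ ⋯ ⊗ ℂ²` of `ℓ + 1 + w` qubits, in its computational basis. -/
abbrev QState (l w : ℕ) : Type := EuclideanSpace ℂ (BasisLabel l w)

/-- The bit that the oracle of `X` returns on index `i`; the indices `i ≥ n`, which only pad the
index register to a whole number of qubits, return `0`. -/
def oracleBit {n : ℕ} (X : Input n) (i : ℕ) : Bool :=
  if h : i < n then X ⟨i, h⟩ else false

/-- The query on basis labels: `(i, b, z) ↦ (i, b ⊕ x_i, z)`. -/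
def queryLabel {n : ℕ} (l w : ℕ) (X : Input n) (s : BasisLabel l w) : BasisLabel l w :=
  (s.1, xor s.2.1 (oracleBit X s.1), s.2.2)

theorem queryLabel_involutive {n : ℕ} (l w : ℕ) (X : Input n) :
    Function.Involutive (queryLabel l w X) := by
  rintro ⟨i, b, z⟩
  simp [queryLabel]

/-- The query operator `Q_X`: the unitary that permutes the computational basis by
`|i⟩|b⟩|z⟩ ↦ |i⟩|b ⊕ x_i⟩|z⟩`. -/
def queryOp {n : ℕ} (l w : ℕ) (X : Input n) : QState l w ≃ₗᵢ[ℂ] QState l w :=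
  LinearIsometryEquiv.piLpCongrLeft 2 ℂ ℂ (queryLabel_involutive l w X).toPerm

/-- A quantum algorithm with `T` queries for inputs of `n` Boolean variables. -/
structure QuantumAlgorithm (n T : ℕ) where
  /-- number of qubits of the index register -/
  l : ℕ
  /-- number of qubits of the work space -/
  w : ℕ
  /-- the index register can hold every index -/
  index_fits : n ≤ 2 ^ l
  /-- the initial state -/
  init : QState l w
  norm_init : ‖init‖ = 1
  /-- the unitary transformations `U_0, …, U_T`, which do not depend on the input -/
  U : Fin (T + 1) → QState l w ≃ₗᵢ[ℂ] QState l w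
  /-- number of outcomes of the final measurement -/
  M : ℕ
  /-- the final projective measurement -/
  P : Fin M → QState l w →L[ℂ] QState l w
  isStarProjection_P : ∀ j, IsStarProjection (P j)
  sum_P : ∑ j, P j = 1
  /-- the approximation to the mean that is computed from the outcome `j` -/
  estimate : Fin M → ℝ

namespace QuantumAlgorithm

variable {n T : ℕ} (A : QuantumAlgorithm n T) (X : Input n)

/-- The state `U_k Q_X U_{k-1} Q_X ⋯ U_1 Q_X U_0 |ψ_0⟩`, for `k ≤ T`. -/
def stateAfter : (k : ℕ) → k < T + 1 → QState A.l A.w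
  | 0, h => A.U ⟨0, h⟩ A.init
  | k + 1, h => A.U ⟨k + 1, h⟩ (queryOp A.l A.w X (stateAfter k (Nat.lt_of_succ_lt h)))

/-- The final state `|ψ⟩ = U_T Q_X U_{T-1} Q_X ⋯ U_1 Q_X U_0 |ψ_0⟩`. -/
def finalState : QState A.l A.w := A.stateAfter X T (Nat.lt_succ_self T)

/-- `p_X(j)`, the probability of the outcome `j` on input `X`. -/
def outcomeProb (j : Fin A.M) : ℝ := ‖A.P j (A.finalState X)‖ ^ 2

/-- The probabilistic error `e(X,T,p)` on input `X`: the infimum of the `γ` for which the estimate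
of the mean is within `γ` of `a_X` with probability at least `p`. -/
def error (p : ℝ) : ℝ :=
  sInf {γ : ℝ |
    p ≤ ∑ j ∈ Finset.univ.filter (fun j => |mean X - A.estimate j| ≤ γ), A.outcomeProb X j}

/-- The average probabilistic error `∑_X e(X,T,p) μ(X)`. -/
def avgError (μ : Measure (Input n)) (p : ℝ) : ℝ :=
  ∑ X : Input n, A.error X p * μ.real {X}

/-- The average probabilistic error of approximate counting, `n` times that of the mean. -/
def avgCountError (μ : Measure (Input n)) (p : ℝ) : ℝ := (n : ℝ) * A.avgError μ p

end QuantumAlgorithm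

end QuantumMean

end

/-! ### Growth of the distance between states under queries -/

namespace QuantumMean

/-! This is an adversary argument on two layers of the cube. A uniform `X` of weight `k` is coupled
with `Y`, got by turning `m` random zeros of `X` into ones. Since `k` and `n - k` are at least `θ
n`, each variable differs with probability at most `m / (θ n)` given either input, so one query
raises the mean squared distance of the two states by at most `4 m / (θ n)`
(`sum_norm_stateAfter_sub_sq_le`, `exists_layer_coupling`).

If the counting error averaged over both layers is well below `m / 2`, thresholding the estimate
tells the layers apart, so the final mean squared distance is bounded below by a constant and `T =
Ω(n / m)` (`sq_le_of_layerAvg_le`).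

As `μ` dominates a multiple of the mixture of the layers in `I`, the layer errors average `O(Δ)`.
Since `Δ = o(|I|)`, pigeonholing gives two layers of `I` at distance `m` of order `max(Δ, 1)` with
errors this small (`exists_add_mem_and_mul_card_le`). -/

theorem queryOp_apply {n : ℕ} (l w : ℕ) (X : Input n) (ψ : QState l w) (s : BasisLabel l w) :
    queryOp l w X ψ s = ψ (queryLabel l w X s) := rfl

/-- One query on two inputs separates the states only on the indices where the inputs differ. -/
theorem norm_queryOp_sub_sq_le {n : ℕ} (l w : ℕ) (X Y : Input n) (ψ φ : QState l w) :
    ‖queryOp l w X ψ - queryOp l w Y φ‖ ^ 2 ≤ ‖ψ - φ‖ ^ 2 +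
      2 * ∑ s : BasisLabel l w,
        (if oracleBit X s.1 = oracleBit Y s.1 then 0 else 1) * (‖ψ s‖ ^ 2 + ‖φ s‖ ^ 2) := by
  set d : BasisLabel l w → ℝ := fun s => if oracleBit X s.1 = oracleBit Y s.1 then 0 else 1
    with hd
  set eX := (queryLabel_involutive l w X).toPerm
  set eY := (queryLabel_involutive l w Y).toPerm
  have hX : ∀ s, eX s = queryLabel l w X s := fun _ => rfl
  have hY : ∀ s, eY s = queryLabel l w Y s := fun _ => rfl
  -- `eX` and `eY` keep the index register, and `d` depends on nothing else.
  have hreindex : ∑ s, d s * ‖φ (eY (eX s))‖ ^ 2 = ∑ s, d s * ‖φ s‖ ^ 2 :=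
    Equiv.sum_comp (eX.trans eY) fun s => d s * ‖φ s‖ ^ 2
  -- Where the bits agree the two queries cancel; elsewhere `‖a - b‖² ≤ 2 (‖a‖² + ‖b‖²)`.
  have hpt : ∀ s, ‖ψ s - φ (eY (eX s))‖ ^ 2 ≤
      ‖ψ s - φ s‖ ^ 2 + 2 * (d s * ‖ψ s‖ ^ 2 + d s * ‖φ (eY (eX s))‖ ^ 2) := by
    rintro ⟨i, b, z⟩
    by_cases h : oracleBit X i = oracleBit Y i
    · have : eY (eX (i, b, z)) = (i, b, z) := by
        simp [hX, hY, queryLabel, h]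
      simp [this, hd, h]
    · have h1 := norm_sub_le (ψ (i, b, z)) (φ (eY (eX (i, b, z))))
      have h2 := norm_nonneg (ψ (i, b, z) - φ (eY (eX (i, b, z))))
      have h3 := sq_nonneg ‖ψ (i, b, z) - φ (i, b, z)‖
      simp only [hd, h, if_false]
      nlinarith [sq_nonneg (‖ψ (i, b, z)‖ - ‖φ (eY (eX (i, b, z)))‖)]
  have hsplit : ∑ s, ‖ψ (eX s) - φ (eY s)‖ ^ 2 = ∑ s, ‖ψ s - φ (eY (eX s))‖ ^ 2 := by
    rw [← Equiv.sum_comp eX fun s => ‖ψ s - φ (eY (eX s))‖ ^ 2]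
    refine Finset.sum_congr rfl fun s _ => ?_
    rw [show eX (eX s) = s from queryLabel_involutive l w X s]
  rw [EuclideanSpace.norm_sq_eq, EuclideanSpace.norm_sq_eq]
  simp only [PiLp.sub_apply, queryOp_apply]
  calc _ = ∑ s, ‖ψ s - φ (eY (eX s))‖ ^ 2 := hsplit
    _ ≤ ∑ s, (‖ψ s - φ s‖ ^ 2 + 2 * (d s * ‖ψ s‖ ^ 2 + d s * ‖φ (eY (eX s))‖ ^ 2)) :=
        Finset.sum_le_sum fun s _ => hpt s
    _ = _ := by
        rw [Finset.sum_add_distrib, ← Finset.mul_sum, Finset.sum_add_distrib, hreindex,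
          ← Finset.sum_add_distrib]
        simp only [mul_add, hd]

namespace QuantumAlgorithm

variable {n T : ℕ} (A : QuantumAlgorithm n T) (X Y : Input n)

theorem norm_stateAfter : ∀ (k : ℕ) (h : k < T + 1), ‖A.stateAfter X k h‖ = 1
  | 0, h => by simp [stateAfter, A.norm_init]
  | k + 1, h => by simp [stateAfter, norm_stateAfter k]

/-- The weight `v` of a coupling bounds the total amplitude weighted by the disagreement rate. -/
theorem sum_disagree_mul_normSq_le {v : Input n → ℝ} {ε : ℝ} (hε : 0 ≤ ε) (hv : ∀ Y, 0 ≤ v Y)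
    (h : ∀ i, ∑ Y, v Y * (if X i = Y i then 0 else 1) ≤ ε * ∑ Y, v Y)
    (ψ : QState A.l A.w) (hψ : ‖ψ‖ = 1) :
    ∑ Y, v Y * ∑ s : BasisLabel A.l A.w,
      (if oracleBit X s.1 = oracleBit Y s.1 then 0 else 1) * ‖ψ s‖ ^ 2 ≤ ε * ∑ Y, v Y := by
  have hsum : ∑ s, ‖ψ s‖ ^ 2 = 1 := by rw [← EuclideanSpace.norm_sq_eq, hψ, one_pow]
  have hbit : ∀ i : ℕ,
      ∑ Y, v Y * (if oracleBit X i = oracleBit Y i then 0 else 1) ≤ ε * ∑ Y, v Y := by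
    intro i
    by_cases hi : i < n
    · simpa [oracleBit, hi] using h ⟨i, hi⟩
    -- Padding indices return `0` on every input, so they never disagree.
    · simpa [oracleBit, hi] using mul_nonneg hε (Finset.sum_nonneg fun Y _ => hv Y)
  calc _ = ∑ s, (∑ Y, v Y * (if oracleBit X s.1 = oracleBit Y s.1 then 0 else 1)) *
        ‖ψ s‖ ^ 2 := by
        simp only [Finset.mul_sum, Finset.sum_mul, ← mul_assoc]
        exact Finset.sum_comm
    _ ≤ ∑ s, (ε * ∑ Y, v Y) * ‖ψ s‖ ^ 2 :=
        Finset.sum_le_sum fun s _ => mul_le_mul_of_nonneg_right (hbit _) (sq_nonneg _)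
    _ = ε * ∑ Y, v Y := by rw [← Finset.mul_sum, hsum, mul_one]

/-- The adversary bound: under a coupling `v` of two inputs such that, given either input, every
variable differs with conditional probability at most `ε`, each query contributes at most `4 ε` to
the mean squared distance of the states. -/
theorem sum_norm_stateAfter_sub_sq_le {v : Input n → Input n → ℝ} {ε : ℝ} (hε : 0 ≤ ε)
    (hv : ∀ X Y, 0 ≤ v X Y) (hv1 : ∑ X, ∑ Y, v X Y = 1)
    (hl : ∀ X i, ∑ Y, v X Y * (if X i = Y i then 0 else 1) ≤ ε * ∑ Y, v X Y)
    (hr : ∀ Y i, ∑ X, v X Y * (if Y i = X i then 0 else 1) ≤ ε * ∑ X, v X Y) :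
    ∀ (k : ℕ) (h : k < T + 1),
      ∑ X, ∑ Y, v X Y * ‖A.stateAfter X k h - A.stateAfter Y k h‖ ^ 2 ≤ 4 * k * ε
  | 0, h => by simp [stateAfter]
  | k + 1, h => by
    have hk : k < T + 1 := Nat.lt_of_succ_lt h
    have ih := sum_norm_stateAfter_sub_sq_le hε hv hv1 hl hr k hk
    set ψ := fun X => A.stateAfter X k hk
    have hψ : ∀ X, ‖ψ X‖ = 1 := fun X => A.norm_stateAfter X k hk
    set d : Input n → Input n → BasisLabel A.l A.w → ℝ :=
      fun X Y s => if oracleBit X s.1 = oracleBit Y s.1 then 0 else 1 with hd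
    have hd' : ∀ X Y s, d X Y s = d Y X s := fun X Y s => by simp only [hd, eq_comm]
    have hL : ∑ X, ∑ Y, v X Y * ∑ s, d X Y s * ‖ψ X s‖ ^ 2 ≤ ε := by
      calc _ ≤ ∑ X, ε * ∑ Y, v X Y := Finset.sum_le_sum fun X _ =>
            A.sum_disagree_mul_normSq_le X hε (hv X) (hl X) (ψ X) (hψ X)
        _ = ε := by rw [← Finset.mul_sum, hv1, mul_one]
    have hR : ∑ X, ∑ Y, v X Y * ∑ s, d X Y s * ‖ψ Y s‖ ^ 2 ≤ ε := by
      rw [Finset.sum_comm]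
      calc _ ≤ ∑ Y, ε * ∑ X, v X Y := Finset.sum_le_sum fun Y _ => by
            simp only [hd' _ Y]
            exact A.sum_disagree_mul_normSq_le Y hε (fun X => hv X Y) (hr Y) (ψ Y) (hψ Y)
        _ = ε := by rw [← Finset.mul_sum, Finset.sum_comm, hv1, mul_one]
    -- The common unitary preserves distances, so only the query matters; it adds at most `2 (ε +
    -- ε)`.
    calc ∑ X, ∑ Y, v X Y * ‖A.stateAfter X (k + 1) h - A.stateAfter Y (k + 1) h‖ ^ 2
        ≤ ∑ X, ∑ Y, (v X Y * ‖ψ X - ψ Y‖ ^ 2 +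
          2 * (v X Y * ∑ s, d X Y s * ‖ψ X s‖ ^ 2 + v X Y * ∑ s, d X Y s * ‖ψ Y s‖ ^ 2)) := by
          refine Finset.sum_le_sum fun X _ => Finset.sum_le_sum fun Y _ => ?_
          have := mul_le_mul_of_nonneg_left
            (norm_queryOp_sub_sq_le A.l A.w X Y (ψ X) (ψ Y)) (hv X Y)
          rw [stateAfter, stateAfter, ← map_sub, LinearIsometryEquiv.norm_map]
          refine this.trans_eq ?_
          simp only [mul_add, Finset.sum_add_distrib, hd]
          ring
      _ ≤ 4 * (k + 1 : ℕ) * ε := by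
          simp only [Finset.sum_add_distrib, ← Finset.mul_sum]
          push_cast
          linarith

/-! ### Outcome probabilities and the probabilistic error -/

/-- For a projection `‖P ψ‖² = re ⟪P ψ, ψ⟫` is linear in `P`, so `∑ P j = 1` suffices; orthogonality
of the ranges is not needed. -/
theorem sum_norm_P_sq (ψ : QState A.l A.w) : ∑ j, ‖A.P j ψ‖ ^ 2 = ‖ψ‖ ^ 2 := by
  have h : ∀ j, ‖A.P j ψ‖ ^ 2 = RCLike.re (inner ℂ (A.P j ψ) ψ) := by
    intro j
    have hs : (A.P j).adjoint = A.P j := (A.isStarProjection_P j).isSelfAdjoint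
    have hi : A.P j (A.P j ψ) = A.P j ψ :=
      congrArg (fun f => f ψ) (A.isStarProjection_P j).isIdempotentElem
    rw [← inner_self_eq_norm_sq (𝕜 := ℂ)]
    conv_lhs => rw [← ContinuousLinearMap.adjoint_inner_left, hs, hi]
  have h2 : ∑ j, A.P j ψ = ψ := by
    rw [← sum_apply, A.sum_P, one_apply_eq_self]
  simp only [h]
  rw [← map_sum, ← sum_inner, h2, inner_self_eq_norm_sq]

theorem sum_outcomeProb : ∑ j, A.outcomeProb X j = 1 := by
  simp [outcomeProb, sum_norm_P_sq, finalState, norm_stateAfter]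

theorem outcomeProb_nonneg (j : Fin A.M) : 0 ≤ A.outcomeProb X j := sq_nonneg _

/-- The probabilities of an event are as close as the final states are. -/
theorem sq_sum_outcomeProb_sub_le (S : Finset (Fin A.M)) :
    (∑ j ∈ S, A.outcomeProb X j - ∑ j ∈ S, A.outcomeProb Y j) ^ 2 ≤
      4 * ‖A.finalState X - A.finalState Y‖ ^ 2 := by
  set ψ := A.finalState X
  set φ := A.finalState Y
  have hψ : ‖ψ‖ = 1 := A.norm_stateAfter X T _
  have hφ : ‖φ‖ = 1 := A.norm_stateAfter Y T _
  have hle : ∀ χ, ∑ j ∈ S, ‖A.P j χ‖ ^ 2 ≤ ‖χ‖ ^ 2 := fun χ =>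
    (Finset.sum_le_univ_sum_of_nonneg fun j => sq_nonneg _).trans_eq (A.sum_norm_P_sq χ)
  have hpt : ∀ j, |‖A.P j ψ‖ ^ 2 - ‖A.P j φ‖ ^ 2| ≤
      ‖A.P j (ψ - φ)‖ * (‖A.P j ψ‖ + ‖A.P j φ‖) := by
    intro j
    rw [sq_sub_sq, abs_mul, abs_of_nonneg (by positivity), mul_comm, map_sub]
    exact mul_le_mul_of_nonneg_right (abs_norm_sub_norm_le _ _) (by positivity)
  have h1 : |∑ j ∈ S, ‖A.P j ψ‖ ^ 2 - ∑ j ∈ S, ‖A.P j φ‖ ^ 2| ≤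
      ∑ j ∈ S, ‖A.P j (ψ - φ)‖ * (‖A.P j ψ‖ + ‖A.P j φ‖) := by
    rw [← Finset.sum_sub_distrib]
    exact (Finset.abs_sum_le_sum_abs _ _).trans (Finset.sum_le_sum fun j _ => hpt j)
  have h2 := Finset.sum_mul_sq_le_sq_mul_sq S (fun j => ‖A.P j (ψ - φ)‖)
    fun j => ‖A.P j ψ‖ + ‖A.P j φ‖
  have h3 : ∑ j ∈ S, (‖A.P j ψ‖ + ‖A.P j φ‖) ^ 2 ≤ 4 := by
    calc _ ≤ ∑ j ∈ S, (2 * ‖A.P j ψ‖ ^ 2 + 2 * ‖A.P j φ‖ ^ 2) :=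
          Finset.sum_le_sum fun j _ => by nlinarith [sq_nonneg (‖A.P j ψ‖ - ‖A.P j φ‖)]
      _ ≤ 4 := by
          rw [Finset.sum_add_distrib, ← Finset.mul_sum, ← Finset.mul_sum]
          have := hle ψ
          have := hle φ
          simp only [hψ, hφ] at *
          linarith
  calc (∑ j ∈ S, ‖A.P j ψ‖ ^ 2 - ∑ j ∈ S, ‖A.P j φ‖ ^ 2) ^ 2
      ≤ (∑ j ∈ S, ‖A.P j (ψ - φ)‖ * (‖A.P j ψ‖ + ‖A.P j φ‖)) ^ 2 :=
        sq_le_sq.2 (h1.trans (le_abs_self _))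
    _ ≤ (∑ j ∈ S, ‖A.P j (ψ - φ)‖ ^ 2) * ∑ j ∈ S, (‖A.P j ψ‖ + ‖A.P j φ‖) ^ 2 := h2
    _ ≤ ‖ψ - φ‖ ^ 2 * 4 := mul_le_mul (hle _) h3
        (Finset.sum_nonneg fun j _ => sq_nonneg _) (sq_nonneg _)
    _ = _ := mul_comm _ _

/-- For negative `γ` the event is empty and cannot have probability `p > 0`. -/
theorem error_nonneg {p : ℝ} (hp : 0 < p) : 0 ≤ A.error X p := by
  refine Real.sInf_nonneg fun γ hγ => ?_
  by_contra! h
  rw [Set.mem_ofPred_eq, Finset.filter_false_of_mem, Finset.sum_empty] at hγ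
  · exact absurd hp hγ.not_gt
  · exact fun j _ hj => absurd (abs_nonneg (mean X - A.estimate j)) (by linarith)

/-- Above the probabilistic error, the estimate is accurate with probability at least `p`. -/
theorem le_sum_outcomeProb_of_error_lt {p γ : ℝ} (hp : p ≤ 1) (h : A.error X p < γ) :
    p ≤ ∑ j ∈ Finset.univ.filter (fun j => |mean X - A.estimate j| ≤ γ),
      A.outcomeProb X j := by
  have hne : {γ : ℝ | p ≤ ∑ j ∈ Finset.univ.filter (fun j => |mean X - A.estimate j| ≤ γ),
      A.outcomeProb X j}.Nonempty := by
    -- This `γ` exceeds every single deviation, so the event is certain; hence the infimum is not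
    -- the default value of `sInf ∅`.
    refine ⟨∑ j, |mean X - A.estimate j|, ?_⟩
    rw [Set.mem_ofPred_eq, Finset.filter_true_of_mem, sum_outcomeProb]
    · exact hp
    · exact fun j _ => Finset.single_le_sum (f := fun j => |mean X - A.estimate j|)
        (fun j _ => abs_nonneg _) (Finset.mem_univ j)
  obtain ⟨γ', hγ', hlt⟩ := exists_lt_of_csInf_lt hne h
  refine le_trans hγ' (Finset.sum_le_sum_of_subset_of_nonneg ?_ fun j _ _ =>
    A.outcomeProb_nonneg X j)
  exact Finset.monotone_filter_right _ fun j _ hj => le_trans hj hlt.le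

/-- If the estimate being accurate up to `L / n` forces the event `S`, then `S` is likely up to a
Markov-type term. -/
theorem sub_le_sum_outcomeProb {p L : ℝ} (hp0 : 0 < p) (hp : p ≤ 1) (hL : 0 < L) (hn : 0 < n)
    (S : Finset (Fin A.M)) (hS : ∀ j, |mean X - A.estimate j| ≤ L / n → j ∈ S) :
    p - n * A.error X p / L ≤ ∑ j ∈ S, A.outcomeProb X j := by
  have hn' : (0 : ℝ) < n := Nat.cast_pos.2 hn
  rcases lt_or_ge (A.error X p) (L / n) with h | h
  · have h0 : p ≤ ∑ j ∈ S, A.outcomeProb X j :=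
      (A.le_sum_outcomeProb_of_error_lt X hp h).trans <|
        Finset.sum_le_sum_of_subset_of_nonneg (fun j hj => hS j (Finset.mem_filter.1 hj).2)
          fun j _ _ => A.outcomeProb_nonneg X j
    have := A.error_nonneg X hp0
    have : 0 ≤ n * A.error X p / L := by positivity
    linarith
  -- Here the Markov term is at least `1 ≥ p`, and the bound is trivial.
  · have h1 : 1 ≤ n * A.error X p / L := by
      rw [le_div_iff₀ hL, one_mul]
      rw [div_le_iff₀ hn'] at h
      linarith
    have h2 : 0 ≤ ∑ j ∈ S, A.outcomeProb X j :=
      Finset.sum_nonneg fun j _ => A.outcomeProb_nonneg X j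
    linarith

end QuantumAlgorithm
end QuantumMean

/-! ### Counting in the layers of the cube and the coupling -/

namespace QuantumMean

/-- The set of the variables with the value `b`. -/
def levelSet {n : ℕ} (b : Bool) (X : Input n) : Finset (Fin n) := Finset.univ.filter fun i => X i = b

theorem mem_levelSet {n : ℕ} {b : Bool} {X : Input n} {i : Fin n} :
    i ∈ levelSet b X ↔ X i = b := by
  simp [levelSet]

theorem card_levelSet_true {n : ℕ} (X : Input n) : (levelSet true X).card = weight X := rfl

theorem card_levelSet_false {n : ℕ} (X : Input n) : (levelSet false X).card + weight X = n := by
  have h := Finset.card_filter_add_card_filter_not (s := Finset.univ) fun i => X i = true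
  simp only [Bool.not_eq_true, Finset.card_univ, Fintype.card_fin] at h
  rw [add_comm]
  exact h

theorem card_filter_levelSet_subset {n : ℕ} (b : Bool) (A : Finset (Fin n)) (r : ℕ) :
    (Finset.univ.filter fun X : Input n => levelSet b X ⊆ A ∧ (levelSet b X).card = r).card =
      A.card.choose r := by
  rw [← Finset.card_powersetCard]
  refine Finset.card_bij (fun X _ => levelSet b X) ?_ ?_ ?_
  · intro X hX
    simpa [Finset.mem_powersetCard] using hX
  · intro X _ Y _ h
    funext i
    have := congrArg (i ∈ ·) h
    simp only [mem_levelSet, eq_iff_iff] at this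
    cases b <;> cases hX : X i <;> cases hY : Y i <;> simp_all
  · intro B hB
    have h : levelSet b (fun i => if i ∈ B then b else !b) = B := by
      ext i
      by_cases hi : i ∈ B <;> simp [mem_levelSet, hi]
    refine ⟨fun i => if i ∈ B then b else !b, ?_, h⟩
    rw [Finset.mem_filter, h]
    exact ⟨Finset.mem_univ _, Finset.mem_powersetCard.1 hB⟩

/-- Among the `r`-subsets of `A`, the fraction of those which miss a given element of `A` is
`(|A| - r) / |A|`. -/
theorem card_filter_levelSet_subset_mul_le {n : ℕ} (b : Bool) (Y : Input n) (r : ℕ) (i : Fin n) :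
    (Finset.univ.filter fun X : Input n =>
        (levelSet b X ⊆ levelSet b Y ∧ (levelSet b X).card = r) ∧ Y i ≠ X i).card *
          (levelSet b Y).card ≤
      (Finset.univ.filter fun X : Input n =>
        levelSet b X ⊆ levelSet b Y ∧ (levelSet b X).card = r).card *
          ((levelSet b Y).card - r) := by
  by_cases hi : i ∈ levelSet b Y
  · have hsub : (Finset.univ.filter fun X : Input n =>
        (levelSet b X ⊆ levelSet b Y ∧ (levelSet b X).card = r) ∧ Y i ≠ X i) ⊆
        Finset.univ.filter fun X : Input n =>
          levelSet b X ⊆ (levelSet b Y).erase i ∧ (levelSet b X).card = r := by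
      refine Finset.monotone_filter_right _ fun X _ hX => ⟨?_, hX.1.2⟩
      refine Finset.subset_erase.2 ⟨hX.1.1, fun h => hX.2 ?_⟩
      rw [mem_levelSet.1 hi, mem_levelSet.1 h]
    refine (Nat.mul_le_mul_right _ (Finset.card_le_card hsub)).trans ?_
    -- With `a` the size of the level set of `Y`, the claim becomes `C(a-1, r) a = C(a, r) (a - r)`.
    rw [card_filter_levelSet_subset, card_filter_levelSet_subset]
    have hcard := Finset.card_erase_add_one hi
    rw [← hcard, Nat.choose_mul_succ_eq]
  · rw [Finset.card_eq_zero.2, zero_mul]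
    · exact Nat.zero_le _
    · refine Finset.filter_false_of_mem fun X _ hX => hX.2 ?_
      have h : i ∉ levelSet b X := fun h => hi (hX.1.1 h)
      rw [mem_levelSet] at hi h
      cases b <;> simp_all

theorem card_filter_weight_eq {n : ℕ} (r : ℕ) :
    (Finset.univ.filter fun X : Input n => weight X = r).card = n.choose r := by
  simpa [card_levelSet_true] using card_filter_levelSet_subset (n := n) true Finset.univ r

/-- `Y` arises from `X`, of weight `k`, by changing `m` zeros to ones. -/
def Extends {n : ℕ} (k m : ℕ) (X Y : Input n) : Prop :=
  (weight X = k ∧ weight Y = k + m) ∧ levelSet true X ⊆ levelSet true Y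

theorem extends_iff_true {n k m : ℕ} {X Y : Input n} (hY : weight Y = k + m) :
    Extends k m X Y ↔
      levelSet true X ⊆ levelSet true Y ∧ (levelSet true X).card = k := by
  simp [Extends, hY, card_levelSet_true, and_comm]

/-- Seen from `X`, the zero set shrinks; seen from `Y`, the set of ones does. Thus one count of
subsets of a level set serves both directions. -/
theorem extends_iff_false {n k m : ℕ} {X Y : Input n} (hX : weight X = k) (hk : k + m ≤ n) :
    Extends k m X Y ↔
      levelSet false Y ⊆ levelSet false X ∧ (levelSet false Y).card = n - (k + m) := by
  have h1 : weight Y = k + m ↔ (levelSet false Y).card = n - (k + m) := by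
    have := card_levelSet_false Y
    omega
  have h2 : levelSet true X ⊆ levelSet true Y ↔ levelSet false Y ⊆ levelSet false X := by
    simp only [Finset.subset_iff, mem_levelSet]
    refine forall_congr' fun i => ?_
    cases X i <;> cases Y i <;> simp
  rw [Extends, h1, h2, and_comm]
  simp [hX]

open Classical in
theorem card_filter_extends_right {n k m : ℕ} {X : Input n} (hX : weight X = k) (hk : k + m ≤ n) :
    (Finset.univ.filter fun Y => Extends k m X Y).card = (n - k).choose (n - (k + m)) := by
  simp only [extends_iff_false hX hk]
  have h := card_levelSet_false X
  rw [show n - k = (levelSet false X).card by omega]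
  convert card_filter_levelSet_subset false (levelSet false X) (n - (k + m))

open Classical in
theorem card_filter_extends_left {n k m : ℕ} {Y : Input n} (hY : weight Y = k + m) :
    (Finset.univ.filter fun X => Extends k m X Y).card = (k + m).choose k := by
  simp only [extends_iff_true hY]
  rw [← hY, ← card_levelSet_true]
  convert card_filter_levelSet_subset true (levelSet true Y) k

open Classical in
theorem card_filter_extends_right_ne_mul_le {n k m : ℕ} (X : Input n) (hk : k + m ≤ n)
    (i : Fin n) :
    (Finset.univ.filter fun Y => Extends k m X Y ∧ X i ≠ Y i).card * (n - k) ≤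
      (Finset.univ.filter fun Y => Extends k m X Y).card * m := by
  by_cases hX : weight X = k
  · simp only [extends_iff_false hX hk]
    have h := card_levelSet_false X
    have h2 := card_filter_levelSet_subset_mul_le false X (n - (k + m)) i
    rw [show (levelSet false X).card = n - k by omega,
      show n - k - (n - (k + m)) = m by omega] at h2
    convert h2
  · simp [Extends, hX]

open Classical in
theorem card_filter_extends_left_ne_mul_le {n k m : ℕ} (Y : Input n) (i : Fin n) :
    (Finset.univ.filter fun X => Extends k m X Y ∧ Y i ≠ X i).card * (k + m) ≤
      (Finset.univ.filter fun X => Extends k m X Y).card * m := by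
  by_cases hY : weight Y = k + m
  · simp only [extends_iff_true hY]
    have h2 := card_filter_levelSet_subset_mul_le true Y k i
    rw [show (levelSet true Y).card = k + m from hY, Nat.add_sub_cancel_left] at h2
    convert h2
  · simp [Extends, hY]

/-- The average of `a` over the inputs of weight `r`. -/
noncomputable def layerAvg {n : ℕ} (a : Input n → ℝ) (r : ℕ) : ℝ :=
  ∑ X, (if weight X = r then 1 / (n.choose r : ℝ) else 0) * a X

theorem layerAvg_nonneg {n : ℕ} {a : Input n → ℝ} (ha : ∀ X, 0 ≤ a X) (r : ℕ) :
    0 ≤ layerAvg a r :=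
  Finset.sum_nonneg fun X _ => mul_nonneg (by split_ifs <;> positivity) (ha X)

theorem sum_layer_weight {n r : ℕ} (hr : r ≤ n) :
    ∑ X : Input n, (if weight X = r then 1 / (n.choose r : ℝ) else 0) = 1 := by
  rw [← Finset.sum_filter, Finset.sum_const, card_filter_weight_eq, nsmul_eq_mul]
  have : (n.choose r : ℝ) ≠ 0 := Nat.cast_ne_zero.2 (Nat.choose_pos hr).ne'
  field_simp

/-- A coupling of the uniform distributions on the inputs of weight `k` and of weight `k + m` such
that, given either input, every variable differs with conditional probability at most
`m / (θ n)`. -/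
theorem exists_layer_coupling {n k m : ℕ} {θ : ℝ} (hkm : k + m ≤ n) (hθ : 0 < θ * n)
    (h1 : θ * n ≤ k) (h2 : θ * n ≤ n - k) :
    ∃ v : Input n → Input n → ℝ, (∀ X Y, 0 ≤ v X Y) ∧
      (∀ X, ∑ Y, v X Y = if weight X = k then 1 / (n.choose k : ℝ) else 0) ∧
      (∀ Y, ∑ X, v X Y = if weight Y = k + m then 1 / (n.choose (k + m) : ℝ) else 0) ∧
      (∀ X Y, v X Y ≠ 0 → weight X = k ∧ weight Y = k + m) ∧
      (∀ X i, ∑ Y, v X Y * (if X i = Y i then 0 else 1) ≤ m / (θ * n) * ∑ Y, v X Y) ∧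
      (∀ Y i, ∑ X, v X Y * (if Y i = X i then 0 else 1) ≤ m / (θ * n) * ∑ X, v X Y) := by
  classical
  set q : ℝ := 1 / (n.choose k * (n - k).choose (n - (k + m)) : ℝ) with hq
  have hq0 : 0 ≤ q := by positivity
  have hk0 : (n.choose k : ℝ) ≠ 0 := Nat.cast_ne_zero.2 (Nat.choose_pos (by omega)).ne'
  have hd0 : ((n - k).choose (n - (k + m)) : ℝ) ≠ 0 :=
    Nat.cast_ne_zero.2 (Nat.choose_pos (by omega)).ne'
  -- Double counting of the pairs `(X, Y)`: it makes the second marginal uniform too.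
  have hcount : n.choose k * (n - k).choose (n - (k + m)) =
      n.choose (k + m) * (k + m).choose k := by
    rw [Nat.choose_mul (Nat.le_add_right _ _),
      show n - (k + m) = n - k - m by omega, Nat.choose_symm (by omega), Nat.add_sub_cancel_left]
  have hrow : ∀ X : Input n, ∑ Y, (if Extends k m X Y then q else 0) =
      if weight X = k then 1 / (n.choose k : ℝ) else 0 := by
    intro X
    rw [← Finset.sum_filter, Finset.sum_const, nsmul_eq_mul]
    split_ifs with hX
    · rw [card_filter_extends_right hX hkm, hq]
      field_simp
    · simp [Extends, hX]
  have hcol : ∀ Y : Input n, ∑ X, (if Extends k m X Y then q else 0) =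
      if weight Y = k + m then 1 / (n.choose (k + m) : ℝ) else 0 := by
    intro Y
    rw [← Finset.sum_filter, Finset.sum_const, nsmul_eq_mul]
    split_ifs with hY
    · have : ((k + m).choose k : ℝ) ≠ 0 := Nat.cast_ne_zero.2 (Nat.choose_pos (by omega)).ne'
      rw [card_filter_extends_left hY, hq, ← Nat.cast_mul, hcount, Nat.cast_mul]
      field_simp
    · simp [Extends, hY]
  have hratio : ∀ (a b : ℕ) (N : ℝ), θ * n ≤ N → (a : ℝ) * N ≤ b * m →
      (a : ℝ) * q ≤ m / (θ * n) * (b * q) := by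
    intro a b N hN hab
    rw [div_mul_eq_mul_div, le_div_iff₀ hθ]
    have := mul_le_mul_of_nonneg_left hN (Nat.cast_nonneg (α := ℝ) a)
    nlinarith
  refine ⟨fun X Y => if Extends k m X Y then q else 0, fun X Y => ?_, hrow, hcol, ?_, ?_, ?_⟩
  · dsimp only
    split_ifs <;> simp [hq0]
  · intro X Y h
    by_contra hne
    exact h (if_neg fun hE => hne hE.1)
  · intro X i
    have h := card_filter_extends_right_ne_mul_le X hkm i
    have h' : ((Finset.univ.filter fun Y => Extends k m X Y ∧ X i ≠ Y i).card : ℝ) *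
        ((n : ℝ) - k) ≤ (Finset.univ.filter fun Y => Extends k m X Y).card * m := by
      rw [← Nat.cast_sub (by omega)]
      exact_mod_cast h
    convert hratio _ _ _ h2 h' using 1
    · rw [← nsmul_eq_mul, ← Finset.sum_const, Finset.sum_filter]
      refine Finset.sum_congr rfl fun Y _ => ?_
      by_cases hE : Extends k m X Y <;> by_cases hi : X i = Y i <;> simp [hE, hi]
    · rw [← nsmul_eq_mul, ← Finset.sum_const, Finset.sum_filter]
  · intro Y i
    have h := card_filter_extends_left_ne_mul_le (k := k) (m := m) Y i
    have h' : ((Finset.univ.filter fun X => Extends k m X Y ∧ Y i ≠ X i).card : ℝ) *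
        ((k : ℝ) + m) ≤ (Finset.univ.filter fun X => Extends k m X Y).card * m := by
      exact_mod_cast h
    convert hratio _ _ _ (h1.trans (le_add_of_nonneg_right (Nat.cast_nonneg m))) h' using 1
    · rw [← nsmul_eq_mul, ← Finset.sum_const, Finset.sum_filter]
      refine Finset.sum_congr rfl fun X _ => ?_
      by_cases hE : Extends k m X Y <;> by_cases hi : Y i = X i <;> simp [hE, hi]
    · rw [← nsmul_eq_mul, ← Finset.sum_const, Finset.sum_filter]

/-! ### The query bound from two layers -/

/-- An algorithm that on average over the inputs of weight `k`, and of weight `k + m`, counts to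
within much less than `m` needs `Ω(n / m)` queries. -/
theorem QuantumAlgorithm.sq_le_of_layerAvg_le {n T k m : ℕ} (A : QuantumAlgorithm n T)
    {p L θ : ℝ} (hp : 1 / 2 < p) (hp1 : p ≤ 1) (hL : 0 < L) (hLm : 2 * L < m) (hn : 0 < n)
    (hθ : 0 < θ) (hkm : k + m ≤ n) (h1 : θ * n ≤ k) (h2 : θ * n ≤ n - k)
    (hE : layerAvg (fun X => n * A.error X p) k + layerAvg (fun X => n * A.error X p) (k + m) ≤
      L * ((2 * p - 1) / 2)) :
    ((2 * p - 1) / 2) ^ 2 ≤ 16 * T * (m / (θ * n)) := by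
  have hn' : (0 : ℝ) < n := Nat.cast_pos.2 hn
  have hθn : 0 < θ * n := mul_pos hθ hn'
  obtain ⟨v, hv, hrow, hcol, hsupp, hl, hr⟩ := exists_layer_coupling hkm hθn h1 h2
  have hv1 : ∑ X, ∑ Y, v X Y = 1 := by
    simp only [hrow]
    exact sum_layer_weight (by omega)
  have hD := A.sum_norm_stateAfter_sub_sq_le (by positivity) hv hv1 hl hr T T.lt_succ_self
  -- A count accurate to `L` forces `S` at weight `k`, and forces `Sᶜ` at weight `k + m` because `2
  -- L < m`.
  set S : Finset (Fin A.M) := Finset.univ.filter fun j => n * A.estimate j ≤ k + L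
  set g : Input n → ℝ := fun X => ∑ j ∈ S, A.outcomeProb X j
  have hgX : ∀ X, weight X = k → p - n * A.error X p / L ≤ g X := by
    intro X hX
    refine A.sub_le_sum_outcomeProb X (by linarith) hp1 hL hn S fun j hj => ?_
    rw [mean, hX, abs_le, neg_le_sub_iff_le_add, ← add_div, le_div_iff₀ hn'] at hj
    have := hj.1
    simp only [S, Finset.mem_filter, Finset.mem_univ, true_and]
    linarith
  have hgY : ∀ Y, weight Y = k + m → g Y ≤ 1 - p + n * A.error Y p / L := by
    intro Y hY
    have hc : p - n * A.error Y p / L ≤ ∑ j ∈ Sᶜ, A.outcomeProb Y j := by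
      refine A.sub_le_sum_outcomeProb Y (by linarith) hp1 hL hn Sᶜ fun j hj => ?_
      rw [mean, hY, abs_le, sub_le_iff_le_add, div_le_iff₀ hn', add_mul,
        div_mul_cancel₀ _ hn'.ne'] at hj
      have := hj.2
      push_cast at this
      simp only [S, Finset.mem_compl, Finset.mem_filter, Finset.mem_univ, true_and, not_le]
      linarith
    have hone := A.sum_outcomeProb Y
    rw [← Finset.sum_add_sum_compl S] at hone
    have : g Y = ∑ j ∈ S, A.outcomeProb Y j := rfl
    linarith
  set δ := (2 * p - 1) / 2 with hδ
  have hδ0 : 0 < δ := by rw [hδ]; linarith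
  -- The ideal gap is `2 p - 1 = 2 δ`; by `hE` the Markov terms cost at most `δ` on average.
  have hmean : δ ≤ ∑ X, ∑ Y, v X Y * (g X - g Y) := by
    have hpt : ∀ X Y, v X Y * (2 * δ) - (v X Y * (n * A.error X p / L) +
        v X Y * (n * A.error Y p / L)) ≤ v X Y * (g X - g Y) := by
      intro X Y
      by_cases h0 : v X Y = 0
      · simp [h0]
      · have hX := hgX X (hsupp X Y h0).1
        have hY := hgY Y (hsupp X Y h0).2
        rw [← mul_add, ← mul_sub]
        refine mul_le_mul_of_nonneg_left ?_ (hv X Y)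
        rw [hδ]
        linarith
    have hA : ∑ X, ∑ Y, v X Y * (n * A.error X p / L) =
        layerAvg (fun X => n * A.error X p) k / L := by
      simp only [← Finset.sum_mul, hrow, layerAvg, Finset.sum_div, mul_div_assoc]
    have hB : ∑ X, ∑ Y, v X Y * (n * A.error Y p / L) =
        layerAvg (fun X => n * A.error X p) (k + m) / L := by
      rw [Finset.sum_comm]
      simp only [← Finset.sum_mul, hcol, layerAvg, Finset.sum_div, mul_div_assoc]
    have hsum := Finset.sum_le_sum fun X (_ : X ∈ Finset.univ) =>
      Finset.sum_le_sum fun Y (_ : Y ∈ Finset.univ) => hpt X Y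
    simp only [Finset.sum_add_distrib, Finset.sum_sub_distrib] at hsum
    rw [hA, hB, ← add_div] at hsum
    simp only [← Finset.sum_mul] at hsum
    rw [hv1] at hsum
    have := div_le_of_le_mul₀ hL.le hδ0.le (hE.trans_eq (mul_comm _ _))
    linarith
  -- The tangent bound `2 δ t - δ² ≤ t²` replaces Jensen's inequality when averaging.
  have hpt : ∀ X Y, v X Y * (2 * δ * (g X - g Y) - δ ^ 2) ≤
      v X Y * (4 * ‖A.finalState X - A.finalState Y‖ ^ 2) := by
    intro X Y
    refine mul_le_mul_of_nonneg_left ?_ (hv X Y)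
    have := A.sq_sum_outcomeProb_sub_le X Y S
    nlinarith [sq_nonneg (g X - g Y - δ)]
  have hsum := Finset.sum_le_sum fun X (_ : X ∈ Finset.univ) =>
    Finset.sum_le_sum fun Y (_ : Y ∈ Finset.univ) => hpt X Y
  have hlhs : ∑ X, ∑ Y, v X Y * (2 * δ * (g X - g Y) - δ ^ 2) =
      2 * δ * (∑ X, ∑ Y, v X Y * (g X - g Y)) - δ ^ 2 := by
    conv_rhs => rw [← one_mul (δ ^ 2), ← hv1]
    simp only [Finset.mul_sum, Finset.sum_mul, ← Finset.sum_sub_distrib]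
    exact Finset.sum_congr rfl fun X _ => Finset.sum_congr rfl fun Y _ => by ring
  have hrhs : ∑ X, ∑ Y, v X Y * (4 * ‖A.finalState X - A.finalState Y‖ ^ 2) =
      4 * ∑ X, ∑ Y, v X Y * ‖A.finalState X - A.finalState Y‖ ^ 2 := by
    simp only [Finset.mul_sum]
    exact Finset.sum_congr rfl fun X _ => Finset.sum_congr rfl fun Y _ => by ring
  rw [hlhs, hrhs] at hsum
  have hD' : ∑ X, ∑ Y, v X Y * ‖A.finalState X - A.finalState Y‖ ^ 2 ≤
      4 * T * (m / (θ * n)) := hD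
  nlinarith

/-! ### Choosing the two layers -/

/-- In a set of consecutive integers two elements at distance `m` can be found with a small sum of
values, if the total is small. -/
theorem exists_add_mem_and_mul_card_le {I : Finset ℕ} (hI : (I : Set ℕ).OrdConnected) {m : ℕ}
    (hm : 2 * m < I.card) {E : ℕ → ℝ} (hE : ∀ k, 0 ≤ E k) :
    ∃ k ∈ I, k + m ∈ I ∧ (E k + E (k + m)) * I.card ≤ 4 * ∑ k ∈ I, E k := by
  have hne : I.Nonempty := Finset.card_pos.1 (by omega)
  -- Gives `m ≤ max I`, so the truncated `max I - m` below is a true difference.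
  have hmax : I.card ≤ I.max' hne + 1 := by
    rw [← Finset.card_range (I.max' hne + 1)]
    exact Finset.card_le_card fun k hk => Finset.mem_range_succ_iff.2 (I.le_max' k hk)
  set J := I.filter fun k => k + m ∈ I
  have hJ : I.card ≤ J.card + m := by
    have hsub : I.filter (fun k => ¬ k + m ∈ I) ⊆ Finset.Ioc (I.max' hne - m) (I.max' hne) := by
      intro k hk
      obtain ⟨hk, hkm⟩ := Finset.mem_filter.1 hk
      have hle := I.le_max' k hk
      refine Finset.mem_Ioc.2 ⟨?_, hle⟩
      by_contra! h
      refine hkm (hI.out hk (I.max'_mem hne) ⟨Nat.le_add_right _ _, ?_⟩)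
      omega
    have hc := Finset.card_le_card hsub
    have := Finset.card_filter_add_card_filter_not (s := I) fun k => k + m ∈ I
    simp only [Nat.card_Ioc] at hc
    have : J.card = (I.filter fun k => k + m ∈ I).card := rfl
    omega
  have hJne : J.Nonempty := Finset.card_pos.1 (by omega)
  obtain ⟨k, hk, hmin⟩ := J.exists_min_image (fun k => E k + E (k + m)) hJne
  obtain ⟨hkI, hkm⟩ := Finset.mem_filter.1 hk
  refine ⟨k, hkI, hkm, ?_⟩
  have h1 : J.card • (E k + E (k + m)) ≤ ∑ k ∈ J, (E k + E (k + m)) :=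
    Finset.card_nsmul_le_sum _ _ _ hmin
  have h2 : ∑ k ∈ J, E k ≤ ∑ k ∈ I, E k :=
    Finset.sum_le_sum_of_subset_of_nonneg (Finset.filter_subset _ _) fun k _ _ => hE k
  have h3 : ∑ k ∈ J, E (k + m) ≤ ∑ k ∈ I, E k := by
    refine (Finset.sum_map J (addRightEmbedding m) E).symm.trans_le ?_
    refine Finset.sum_le_sum_of_subset_of_nonneg ?_ fun k _ _ => hE k
    intro l hl
    obtain ⟨k, hk, rfl⟩ := Finset.mem_map.1 hl
    exact (Finset.mem_filter.1 hk).2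
  rw [nsmul_eq_mul, Finset.sum_add_distrib] at h1
  -- At least half of `I` lies in `J`; the minimum over `J` is at most the average `2 ∑ E / |J|`.
  have h4 : (I.card : ℝ) ≤ 2 * J.card := by exact_mod_cast (by omega : I.card ≤ 2 * J.card)
  nlinarith [hE k, hE (k + m), mul_le_mul_of_nonneg_left h4 (add_nonneg (hE k) (hE (k + m)))]

/-- The average over a measure that is bounded from below on the layers of `I` controls the
averages over these layers. -/
theorem mul_sum_layerAvg_le {n : ℕ} {I : Finset ℕ} {μ : Measure (Input n)} {c : ℝ}
    (hμ : ∀ X : Input n, weight X ∈ I →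
      c * (I.card : ℝ)⁻¹ * (1 / (n.choose (weight X) : ℝ)) ≤ μ.real {X})
    {a : Input n → ℝ} (ha : ∀ X, 0 ≤ a X) :
    c * (I.card : ℝ)⁻¹ * ∑ k ∈ I, layerAvg a k ≤ ∑ X, a X * μ.real {X} := by
  simp only [layerAvg]
  rw [Finset.sum_comm, Finset.mul_sum]
  refine Finset.sum_le_sum fun X _ => ?_
  rw [← Finset.sum_mul, Finset.sum_ite_eq, ← mul_assoc, mul_comm (a X)]
  refine mul_le_mul_of_nonneg_right ?_ (ha X)
  split_ifs with h
  · exact hμ X h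
  · simp

end QuantumMean

/-! ### Choice of parameters and conclusion -/

theorem corollary3p1
    (p c θ₁ θ₂ : ℝ) (hp : 1 / 2 < p) (hp1 : p ≤ 1) (hc : 0 < c) (hθ₁ : 0 < θ₁) :
    ∃ C : ℝ, 0 < C ∧
      ∀ (I : ℕ → Finset ℕ) (μ : (n : ℕ) → Measure (QuantumMean.Input n)) (Δ : ℕ → ℝ),
        -- `I n` is a set of consecutive indices in `{0, …, n}`
        (∀ n, I n ⊆ Finset.range (n + 1)) →
        (∀ n, (I n : Set ℕ).OrdConnected) →
        -- its cardinality is `ω(1)`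
        Tendsto (fun n => (I n).card) atTop atTop →
        -- `k (n - k) = Θ(n²)` for every `k ∈ I n`
        (∀ᶠ n : ℕ in atTop, ∀ k ∈ I n,
          θ₁ * (n : ℝ) ^ 2 ≤ (k : ℝ) * ((n : ℝ) - (k : ℝ)) ∧
            (k : ℝ) * ((n : ℝ) - (k : ℝ)) ≤ θ₂ * (n : ℝ) ^ 2) →
        -- the class of probability measures
        (∀ n, IsProbabilityMeasure (μ n)) →
        (∀ᶠ n : ℕ in atTop, ∀ X : QuantumMean.Input n, QuantumMean.weight X ∈ I n →
          c * ((I n).card : ℝ)⁻¹ * (1 / (n.choose (QuantumMean.weight X) : ℝ))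
            ≤ (μ n).real {X}) →
        -- the accuracy
        (∀ n, 0 < Δ n) →
        Δ =o[atTop] (fun n => ((I n).card : ℝ)) →
        ∀ᶠ n : ℕ in atTop, ∀ (T : ℕ) (A : QuantumMean.QuantumAlgorithm n T),
          A.avgCountError (μ n) p ≤ Δ n →
            C * min ((n : ℝ) / Δ n) (n : ℝ) ≤ (T : ℝ) := by
  set K : ℝ := 16 / (c * (2 * p - 1)) + 1 with hK
  have hp2 : 0 < 2 * p - 1 := by linarith
  have hcp : 0 < c * (2 * p - 1) := mul_pos hc hp2
  have hK0 : 0 < K := by positivity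
  refine ⟨((2 * p - 1) / 2) ^ 2 * θ₁ / (16 * K), by positivity, ?_⟩
  intro I μ Δ hIn hI hcard hθ _ hμ hΔ hΔo
  have hsmall := hΔo.def (show 0 < c * (2 * p - 1) / 64 by positivity)
  filter_upwards [hcard.eventually_gt_atTop 4, hθ, hμ, hsmall, eventually_gt_atTop 0]
    with n hcard hθ hμ hsmall hn T A hA
  have hn' : (0 : ℝ) < n := Nat.cast_pos.2 hn
  have hΔ := hΔ n
  have hcard' : (4 : ℝ) < (I n).card := by exact_mod_cast hcard
  rw [Real.norm_of_nonneg hΔ.le, Real.norm_of_nonneg (Nat.cast_nonneg _)] at hsmall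
  -- Makes the error budget `L (2 p - 1) / 2` equal to `4 Δ / c`, which is what the pigeonhole step
  -- yields.
  set L : ℝ := 8 * Δ n / (c * (2 * p - 1)) with hL
  have hL0 : 0 < L := by positivity
  have hLI : 8 * L ≤ (I n).card := by
    rw [hL, mul_div_assoc', div_le_iff₀ hcp]
    linarith
  set m : ℕ := ⌊2 * L⌋₊ + 1 with hm
  have hm1 : 2 * L < m := by
    rw [hm]
    exact_mod_cast Nat.lt_floor_add_one (2 * L)
  have hm2 : (m : ℝ) ≤ 2 * L + 1 := by
    rw [hm]
    push_cast
    linarith [Nat.floor_le (show 0 ≤ 2 * L by positivity)]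
  -- `2 m ≤ 4 L + 2 ≤ |I| / 2 + 2 < |I|`, as `8 L ≤ |I|` and `|I| > 4`.
  have hmI : 2 * m < (I n).card := by
    have : (2 * m : ℝ) < (I n).card := by linarith
    exact_mod_cast this
  set a : QuantumMean.Input n → ℝ := fun X => n * A.error X p with ha
  have ha0 : ∀ X, 0 ≤ a X := fun X =>
    mul_nonneg hn'.le (A.error_nonneg X (by linarith))
  obtain ⟨k, hk, hkm, hsum⟩ := QuantumMean.exists_add_mem_and_mul_card_le (hI n) hmI
    (QuantumMean.layerAvg_nonneg ha0)
  have havg : c * ((I n).card : ℝ)⁻¹ * ∑ k ∈ I n, QuantumMean.layerAvg a k ≤ Δ n := by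
    refine (QuantumMean.mul_sum_layerAvg_le hμ ha0).trans (le_trans (le_of_eq ?_) hA)
    simp only [QuantumMean.QuantumAlgorithm.avgCountError,
      QuantumMean.QuantumAlgorithm.avgError, Finset.mul_sum, ha, mul_assoc]
  have hE : QuantumMean.layerAvg a k + QuantumMean.layerAvg a (k + m) ≤
      L * ((2 * p - 1) / 2) := by
    have hLe : L * ((2 * p - 1) / 2) = 4 * Δ n / c := by
      rw [hL]
      field_simp
      norm_num
    rw [hLe, le_div_iff₀ hc]
    have hI0 : (0 : ℝ) < (I n).card := by linarith
    rw [mul_assoc, inv_mul_eq_div, mul_div_assoc', div_le_iff₀ hI0] at havg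
    refine le_of_mul_le_mul_right ?_ hI0
    nlinarith
  have hkn : k + m ≤ n := Finset.mem_range_succ_iff.1 (hIn n hkm)
  have hkn' : (k : ℝ) ≤ n := by exact_mod_cast (Nat.le_add_right k m).trans hkn
  have hk0 : (0 : ℝ) ≤ k := Nat.cast_nonneg k
  -- In `k (n - k) ≥ θ₁ n²` each factor is at most `n`, so each is at least `θ₁ n`.
  have h1 : θ₁ * n ≤ k := by
    refine le_of_mul_le_mul_right ?_ hn'
    nlinarith [(hθ k hk).1]
  have h2 : θ₁ * n ≤ n - k := by
    refine le_of_mul_le_mul_right ?_ hn'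
    nlinarith [(hθ k hk).1]
  have hmain := A.sq_le_of_layerAvg_le hp hp1 hL0 hm1 hn hθ₁ hkn h1 h2 hE
  rw [mul_div_assoc', le_div_iff₀ (by positivity)] at hmain
  have hmK : (m : ℝ) ≤ K * max (Δ n) 1 := by
    have hLK : 2 * L + 1 = 16 / (c * (2 * p - 1)) * Δ n + 1 := by
      rw [hL]
      ring
    have h16 : 0 ≤ 16 / (c * (2 * p - 1)) := by positivity
    have := mul_le_mul_of_nonneg_left (le_max_left (Δ n) 1) h16
    have := le_max_right (Δ n) 1
    rw [hK, add_mul, one_mul]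
    linarith
  have hmin : min ((n : ℝ) / Δ n) n ≤ n / max (Δ n) 1 := by
    rcases max_choice (Δ n) 1 with h | h <;> rw [h]
    · exact min_le_left _ _
    · rw [div_one]
      exact min_le_right _ _
  have hmax : 0 < max (Δ n) 1 := lt_max_of_lt_right one_pos
  refine (mul_le_mul_of_nonneg_left hmin (by positivity)).trans ?_
  rw [div_mul_div_comm, div_le_iff₀ (by positivity)]
  have := mul_le_mul_of_nonneg_left hmK (show (0 : ℝ) ≤ 16 * T by positivity)
  linarith
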